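/- Let $n \ge 5$. For $j = 1,\dots,n$ let $I_j = (j, j+1, \dots, j+n-3)$, indices being taken modulo $n$ in $\{1,\dots,n\}$. Let ${\bf u} = \{u^1,\dots,u^n\} \subset \mathbb R^n_+$ be nonnegative vectors such that the set of indices of positive entries of $u^j$ is $I_j$ for every $j$, and put $c^t = (c^t_0,\dots,c^t_{n-3}) = u^t_{I_t}$ for $t = 1,\dots,n$ and $c^{t+n} = c^t$ for all $t \ge 1$. Let ${\cal S}^n$ be the space of real symmetric $n \times n$ matrices, ${\cal S}^n_+$ the cone of positive semi-definite ones, ${\cal N}^n$ the cone of element-wise nonnegative ones, and ${\cal C}^n = \{A \in {\cal S}^n \mid x^TAx \ge 0\ \forall\, x \in \mathbb R^n_+\}$ the copositive cone; a matrix in ${\cal C}^n \setminus ({\cal S}^n_+ + {\cal N}^n)$ is called exceptional. Define $$F_{\bf u} = \{A \in {\cal C}^n \mid (u^j)^TAu^j = 0\ \forall j\}, \qquad P_{\bf u} = \{A \in {\cal S}^n_+ \mid (u^j)^TAu^j = 0\ \forall j\}.$$ Let ${\cal L}_{\bf u}$ be the space of real sequences $x = (x_t)_{t\ge 1}$ with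 $\sum_{i=0}^{n-3} c^t_i x_{t+i} = 0$ for all $t \ge 1$, let ${\bf e}_t \in {\cal L}_{\bf u}^*$ be the evaluation functional $x \mapsto x_t$, let ${\mathfrak M} : {\cal L}_{\bf u} \to {\cal L}_{\bf u}$, $(x_t)_t \mapsto (x_{t+n})_t$, be the monodromy, and ${\mathfrak M}^*$ its adjoint. The functionals ${\bf e}_1,\dots,{\bf e}_{n-3}$ form a basis of ${\cal L}_{\bf u}^*$. Let ${\cal A}_{\bf u} = \{A \in {\cal S}^n \mid A_{I_j}u^j_{I_j} = 0\ \forall j\}$, where $A_{I_j}$ is the principal submatrix of $A$ with index set $I_j$, and let $\Lambda$ be the linear map that takes $A \in {\cal A}_{\bf u}$ to the symmetric bilinear form $B$ on ${\cal L}_{\bf u}^*$ with $B({\bf e}_t,{\bf e}_s) = A_{ts}$ for $t,s = 1,\dots,n-3$. Let ${\cal F}_{\bf u}$ be the set of positive semi-definite symmetric bilinear forms $B$ on ${\cal L}_{\bf u}^*$ satisfying the linear equalities $$B({\bf e}_t,{\bf e}_s) = B({\mathfrak M}^*{\bf e}_t,{\mathfrak M}^*{\bf e}_s), \quad t,s =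 1,\dots,n-3;$$ $$B({\bf e}_t,{\bf e}_s) = B({\mathfrak M}^*{\bf e}_t,{\bf e}_s), \quad 1 \le t < s \le n,\ 3 \le s-t \le n-3;$$ and the linear inequalities $$B({\bf e}_t,{\bf e}_{t+2}) \ge B({\mathfrak M}^*{\bf e}_t,{\bf e}_{t+2}), \quad t = 1,\dots,n,$$ and let ${\cal P}_{\bf u} \subset {\cal F}_{\bf u}$ be the subset of forms satisfying all these inequalities with equality. Then $\Lambda$ is injective, its image contains ${\cal F}_{\bf u}$, and $$F_{\bf u} = \Lambda^{-1}[{\cal F}_{\bf u}], \qquad P_{\bf u} = \Lambda^{-1}[{\cal P}_{\bf u}].$$ Moreover, for every $B \in {\cal F}_{\bf u} \setminus {\cal P}_{\bf u}$ all $n$ linear inequalities are strict, and every matrix in $F_{\bf u} \setminus P_{\bf u}$ is exceptional. -/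

import Mathlib

open Matrix

namespace CircCop

/-! ### Copositive matrices -/

/-- `A` belongs to the cone `𝒞ⁿ` of copositive matrices: `A` is symmetric and `xᵀ A x ≥ 0`
for every nonnegative vector `x`. -/
def IsCopositive {n : ℕ} (A : Matrix (Fin n) (Fin n) ℝ) : Prop :=
  A.IsSymm ∧ ∀ x : Fin n → ℝ, (∀ i, 0 ≤ x i) → 0 ≤ x ⬝ᵥ A *ᵥ x

/-- `A` is exceptional: it is copositive, but it is not the sum of a positive semi-definite matrix
and a symmetric element-wise nonnegative matrix. -/
def IsExceptional {n : ℕ} (A : Matrix (Fin n) (Fin n) ℝ) : Prop :=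
  IsCopositive A ∧
    ¬ ∃ P N : Matrix (Fin n) (Fin n) ℝ,
        P.PosSemidef ∧ (N.IsSymm ∧ ∀ i j, 0 ≤ N i j) ∧ A = P + N

/-- The face `F_u` of the copositive cone. -/
def faceF {n : ℕ} (u : Fin n → Fin n → ℝ) : Set (Matrix (Fin n) (Fin n) ℝ) :=
  {A | IsCopositive A ∧ ∀ j, u j ⬝ᵥ A *ᵥ u j = 0}

/-- The face `P_u` of the positive semi-definite cone. -/
def faceP {n : ℕ} (u : Fin n → Fin n → ℝ) : Set (Matrix (Fin n) (Fin n) ℝ) :=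
  {A | A.PosSemidef ∧ ∀ j, u j ⬝ᵥ A *ᵥ u j = 0}

/-! ### Linear systems with periodic coefficients

Time starts at `0`: the index `t` here is the time instant `t + 1` of a system whose time starts
at `1`. -/

/-- The space of solutions `x = (x_t)` of the system `∑_{i=0}^d c^t_i x_{t+i} = 0` for all `t`. -/
def solutions (d : ℕ) (c : ℕ → ℕ → ℝ) : Submodule ℝ (ℕ → ℝ) where
  carrier := {x | ∀ t, ∑ i ∈ Finset.range (d + 1), c t i * x (t + i) = 0}
  add_mem' := by
    intro x y hx hy t
    simp only [Pi.add_apply, mul_add, Finset.sum_add_distrib, hx t, hy t, add_zero]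
  zero_mem' := by
    intro t
    simp
  smul_mem' := by
    intro r x hx t
    simp only [Pi.smul_apply, smul_eq_mul, mul_left_comm _ r, ← Finset.mul_sum, hx t, mul_zero]

/-- The evaluation functional `e_t : x ↦ x_t` on the solution space. -/
def ev {d : ℕ} {c : ℕ → ℕ → ℝ} (t : ℕ) : Module.Dual ℝ (solutions d c) :=
  (LinearMap.proj t).comp (solutions d c).subtype

@[simp]
theorem ev_apply {d : ℕ} {c : ℕ → ℕ → ℝ} (t : ℕ) (x : solutions d c) :
    ev t x = (x : ℕ → ℝ) t := rfl

/-- The monodromy `(x_t) ↦ (x_{t+n})` of a system with `n`-periodic coefficients. -/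
def monodromy {d n : ℕ} {c : ℕ → ℕ → ℝ} (hc : ∀ t, c (t + n) = c t) :
    solutions d c →ₗ[ℝ] solutions d c where
  toFun x := ⟨fun t => (x : ℕ → ℝ) (t + n), by
    intro t
    have h := x.2 (t + n)
    rw [hc t] at h
    simpa only [add_right_comm t n] using h⟩
  map_add' _ _ := rfl
  map_smul' _ _ := rfl

/-- The solution with initial values `v 0, …, v (d-1)`. -/
noncomputable def solutionFrom (d : ℕ) (c : ℕ → ℕ → ℝ) (v : ℕ → ℝ) : ℕ → ℝ
  | t => if _h : t < d then v t else
      -(∑ i : Fin d, c (t - d) i * solutionFrom d c v (t - d + i)) / c (t - d) d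
  termination_by t => t
  decreasing_by omega

theorem solutionFrom_init (d : ℕ) (c : ℕ → ℕ → ℝ) (v : ℕ → ℝ) {t : ℕ} (ht : t < d) :
    solutionFrom d c v t = v t := by
  rw [solutionFrom, dif_pos ht]

theorem solutionFrom_mem (d : ℕ) (c : ℕ → ℕ → ℝ) (hc : ∀ t, c t d ≠ 0) (v : ℕ → ℝ) :
    solutionFrom d c v ∈ solutions d c := by
  intro t
  rw [Finset.sum_range_succ, solutionFrom.eq_1 d c v (t + d), dif_neg (by omega),
    Nat.add_sub_cancel, Finset.sum_range (fun i => c t i * solutionFrom d c v (t + i)),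
    mul_div_cancel₀ _ (hc t)]
  ring

theorem solution_eq_zero {d : ℕ} {c : ℕ → ℕ → ℝ} (hc : ∀ t, c t d ≠ 0) (x : solutions d c)
    (hx : ∀ t < d, (x : ℕ → ℝ) t = 0) (t : ℕ) : (x : ℕ → ℝ) t = 0 := by
  induction t using Nat.strong_induction_on with
  | _ t ih =>
    by_cases ht : t < d
    · exact hx t ht
    · have h := x.2 (t - d)
      rw [Finset.sum_range_succ, Finset.sum_eq_zero, zero_add, Nat.sub_add_cancel (by omega)] at h
      · exact (mul_eq_zero.mp h).resolve_left (hc _)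
      · intro i hi
        rw [Finset.mem_range] at hi
        rw [ih _ (by omega), mul_zero]

/-- A solution is determined by its initial values `(x_0, …, x_{d-1})`, which are arbitrary. -/
noncomputable def initEquiv {d : ℕ} {c : ℕ → ℕ → ℝ} (hc : ∀ t, c t d ≠ 0) :
    solutions d c ≃ₗ[ℝ] (Fin d → ℝ) :=
  LinearEquiv.ofBijective
    (LinearMap.pi fun i : Fin d => (ev (i : ℕ) : Module.Dual ℝ (solutions d c)))
    ⟨by
      rw [← LinearMap.ker_eq_bot, LinearMap.ker_eq_bot']
      intro x hx
      ext t
      exact solution_eq_zero hc x (fun s hs => congrFun hx ⟨s, hs⟩) t,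
    by
      intro v
      refine ⟨⟨solutionFrom d c (fun t => if h : t < d then v ⟨t, h⟩ else 0),
        solutionFrom_mem d c hc _⟩, ?_⟩
      funext i
      change solutionFrom d c _ (i : ℕ) = v i
      rw [solutionFrom_init d c _ i.2, dif_pos i.2]⟩

/-- The basis `e_0, …, e_{d-1}` of the dual of the solution space. -/
noncomputable def evBasis {d : ℕ} {c : ℕ → ℕ → ℝ} (hc : ∀ t, c t d ≠ 0) :
    Module.Basis (Fin d) ℝ (Module.Dual ℝ (solutions d c)) :=
  (Module.Basis.ofEquivFun (initEquiv hc)).dualBasis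

theorem evBasis_apply {d : ℕ} {c : ℕ → ℕ → ℝ} (hc : ∀ t, c t d ≠ 0) (i : Fin d) :
    evBasis hc i = ev (i : ℕ) := by
  ext x
  rw [evBasis, Module.Basis.dualBasis_apply, Module.Basis.ofEquivFun_repr_apply]
  rfl

/-! ### The system attached to the zeros -/

/-- The residue of `t` modulo `n`, as an index of a row or column. -/
def cyc (n : ℕ) [NeZero n] (t : ℕ) : Fin n := Fin.ofNat n t

/-- The ordered index set `I_j = (j, j+1, …, j+n-3)`, taken modulo `n`. -/
def idx (n : ℕ) [NeZero n] (j : Fin n) (i : Fin (n - 2)) : Fin n := cyc n ((j : ℕ) + i)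

/-- The vectors `u^j` are nonnegative, and the set of indices of positive entries of `u^j`
is `I_j`. -/
def HasCirculantSupports {n : ℕ} [NeZero n] (u : Fin n → Fin n → ℝ) : Prop :=
  ∀ j, (∀ i, 0 ≤ u j i) ∧ {i | 0 < u j i} = Set.range (idx n j)

/-- The coefficients of the system `S_u`: the vector `(c^t_i)_{0 ≤ i ≤ n-3}` is `u^t_{I_t}`,
with `t` modulo `n`. -/
def coeff {n : ℕ} [NeZero n] (u : Fin n → Fin n → ℝ) (t i : ℕ) : ℝ :=
  u (cyc n t) (cyc n (t + i))

theorem cyc_add_period (n : ℕ) [NeZero n] (t : ℕ) : cyc n (t + n) = cyc n t := by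
  apply Fin.ext
  simp [cyc]

theorem coeff_periodic {n : ℕ} [NeZero n] (u : Fin n → Fin n → ℝ) (t : ℕ) :
    coeff u (t + n) = coeff u t := by
  funext i
  rw [coeff, coeff, cyc_add_period, add_right_comm, cyc_add_period]

theorem coeff_ne_zero {n : ℕ} [NeZero n] (hn : 5 ≤ n) {u : Fin n → Fin n → ℝ}
    (hu : HasCirculantSupports u) (t : ℕ) : coeff u t (n - 3) ≠ 0 := by
  have h : cyc n (t + (n - 3)) ∈ {i | 0 < u (cyc n t) i} := by
    rw [(hu (cyc n t)).2]
    refine ⟨⟨n - 3, by omega⟩, ?_⟩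
    apply Fin.ext
    simp [idx, cyc]
  exact ne_of_gt h

/-- The solution space `L_u` of the system `S_u` of order `n - 3`. -/
abbrev solSpace {n : ℕ} [NeZero n] (u : Fin n → Fin n → ℝ) : Submodule ℝ (ℕ → ℝ) :=
  solutions (n - 3) (coeff u)

/-- The adjoint `𝔐* : L_u* → L_u*` of the monodromy of `S_u`. -/
def monodromyAdj {n : ℕ} [NeZero n] (u : Fin n → Fin n → ℝ) :
    Module.Dual ℝ (solSpace u) →ₗ[ℝ] Module.Dual ℝ (solSpace u) :=
  (monodromy (d := n - 3) (coeff_periodic u)).dualMap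

theorem monodromyAdj_ev {n : ℕ} [NeZero n] (u : Fin n → Fin n → ℝ) (t : ℕ) :
    monodromyAdj u (ev t) = ev (t + n) := rfl

/-! ### The map `Λ` -/

/-- The space `𝒜_u` of symmetric matrices `A` with `A_{I_j} u^j_{I_j} = 0` for all `j`. -/
def spaceA {n : ℕ} [NeZero n] (u : Fin n → Fin n → ℝ) :
    Submodule ℝ (Matrix (Fin n) (Fin n) ℝ) where
  carrier := {A | A.IsSymm ∧
    ∀ j, A.submatrix (idx n j) (idx n j) *ᵥ (u j ∘ idx n j) = 0}
  add_mem' := by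
    rintro A B ⟨hA, hA'⟩ ⟨hB, hB'⟩
    refine ⟨hA.add hB, fun j => ?_⟩
    rw [Matrix.submatrix_add, Pi.add_apply, Pi.add_apply, Matrix.add_mulVec, hA' j, hB' j,
      add_zero]
  zero_mem' := by
    refine ⟨Matrix.isSymm_zero, fun j => ?_⟩
    rw [Matrix.submatrix_zero, Pi.zero_apply, Pi.zero_apply, Matrix.zero_mulVec]
  smul_mem' := by
    rintro r A ⟨hA, hA'⟩
    refine ⟨hA.smul r, fun j => ?_⟩
    rw [Matrix.submatrix_smul, Pi.smul_apply, Pi.smul_apply, Matrix.smul_mulVec, hA' j, smul_zero]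

/-- The linear map `Λ` taking `A ∈ 𝒜_u` to the bilinear form `B` on `L_u*` with
`B(e_t, e_s) = A_{ts}` on the basis `e_0, …, e_{n-4}`. -/
noncomputable def Lam {n : ℕ} [NeZero n] (hn : 5 ≤ n) {u : Fin n → Fin n → ℝ}
    (hu : HasCirculantSupports u) :
    spaceA u →ₗ[ℝ] LinearMap.BilinForm ℝ (Module.Dual ℝ (solSpace u)) where
  toFun A := Matrix.toBilin (evBasis (coeff_ne_zero hn hu))
    ((A : Matrix (Fin n) (Fin n) ℝ).submatrix (Fin.castLE (Nat.sub_le n 3))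
      (Fin.castLE (Nat.sub_le n 3)))
  map_add' A B := by
    rw [← map_add]
    rfl
  map_smul' r A := by
    rw [RingHom.id_apply, ← map_smul]
    rfl

theorem Lam_ev {n : ℕ} [NeZero n] (hn : 5 ≤ n) {u : Fin n → Fin n → ℝ}
    (hu : HasCirculantSupports u) (A : spaceA u) (t s : Fin (n - 3)) :
    Lam hn hu A (ev t) (ev s) =
      (A : Matrix (Fin n) (Fin n) ℝ) (Fin.castLE (Nat.sub_le n 3) t)
        (Fin.castLE (Nat.sub_le n 3) s) := by
  rw [← evBasis_apply (coeff_ne_zero hn hu), ← evBasis_apply (coeff_ne_zero hn hu)]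
  simp [Lam, Matrix.toBilin_apply, Finsupp.single_apply]

/-! ### The sets of forms -/

/-- The set of positive semi-definite symmetric bilinear forms on `L_u*` cut out by the linear
equalities and inequalities. All time indices are lowered by `1`. -/
def formsF {n : ℕ} [NeZero n] (u : Fin n → Fin n → ℝ) :
    Set (LinearMap.BilinForm ℝ (Module.Dual ℝ (solSpace u))) :=
  {B | B.IsPosSemidef ∧
    (∀ t < n - 3, ∀ s < n - 3,
      B (ev t) (ev s) = B (monodromyAdj u (ev t)) (monodromyAdj u (ev s))) ∧
    (∀ t s, t < s → s < n → 3 ≤ s - t → s - t ≤ n - 3 →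
      B (ev t) (ev s) = B (monodromyAdj u (ev t)) (ev s)) ∧
    ∀ t < n, B (ev t) (ev (t + 2)) ≥ B (monodromyAdj u (ev t)) (ev (t + 2))}

/-- The subset of forms which satisfy all the inequalities with equality. -/
def formsP {n : ℕ} [NeZero n] (u : Fin n → Fin n → ℝ) :
    Set (LinearMap.BilinForm ℝ (Module.Dual ℝ (solSpace u))) :=
  {B | B ∈ formsF u ∧
    ∀ t < n, B (ev t) (ev (t + 2)) = B (monodromyAdj u (ev t)) (ev (t + 2))}

end CircCop

namespace CircCop

/-! ### Zeros of copositive matrices -/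

/-! A zero `z` of a copositive `A` minimizes the form on the orthant, so `A z ≥ 0`, with equality on
the support of `z`. Hence a matrix in the face lies in `spaceA u`: inside each window of `n - 2`
consecutive indices its rows obey the same recursion as the functionals `ev t`. Sliding the window
shows that `B = Λ(A)` satisfies `B(e_t, e_s) = A_{ts}` whenever `|t - s| ≤ n - 3` (`compat_Lam`).
Every pair of residues has representatives that close, whence injectivity.

A pair of residues at cyclic distance at least 3 has two admissible choices of representatives, and
the equalities in `formsF` say that they agree. At cyclic distance 2 only one choice is admissible.
The discrepancy of the other one is the slack of an inequality, and the entries of `A u^j` outside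
the support are positive multiples of slacks (`Compat.mulVec_first`, `Compat.mulVec_last`).

Conversely, if `x_k = 0`, the remaining indices form a window of length `n - 1` in which `A` and `B`
differ only at the two corners, by a slack: `xᵀAx = B(f, f) + 2 x_{k+1} x_{k-1} · slack`
(`Compat.quad_eq`). Subtracting a multiple of a zero from `x` reduces copositivity, and for zero
slacks semi-definiteness, to this case.

If a single slack vanishes, the same formula makes `A` positive semi-definite on a coordinate
hyperplane. As the supports cover all index pairs, `A` is then positive semi-definite
(`IsCopositive.quad_nonneg_of_cover`) and all slacks vanish. The same covering kills any nonnegative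
summand of `A`, which gives exceptionality. -/

theorem posSemidef_iff_symm {n : ℕ} {A : Matrix (Fin n) (Fin n) ℝ} :
    A.PosSemidef ↔ A.IsSymm ∧ ∀ x, 0 ≤ x ⬝ᵥ A *ᵥ x := by
  constructor
  · intro h
    exact ⟨by simpa [IsSymm, IsHermitian, conjTranspose_eq_transpose_of_trivial] using h.1,
      fun x => by simpa using h.dotProduct_mulVec_nonneg x⟩
  · rintro ⟨h, h'⟩
    refine .of_dotProduct_mulVec_nonneg ?_ fun x => by simpa using h' x
    simpa [IsSymm, IsHermitian, conjTranspose_eq_transpose_of_trivial] using h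

theorem dotProduct_mulVec_symm {n : ℕ} {A : Matrix (Fin n) (Fin n) ℝ} (hA : A.IsSymm)
    (x y : Fin n → ℝ) : x ⬝ᵥ A *ᵥ y = y ⬝ᵥ A *ᵥ x := by
  rw [dotProduct_mulVec, ← mulVec_transpose, hA.eq, dotProduct_comm]

theorem quad_add_smul {n : ℕ} {A : Matrix (Fin n) (Fin n) ℝ} (hA : A.IsSymm)
    (x v : Fin n → ℝ) (s : ℝ) :
    (x + s • v) ⬝ᵥ A *ᵥ (x + s • v) =
      x ⬝ᵥ A *ᵥ x + 2 * s * (v ⬝ᵥ A *ᵥ x) + s ^ 2 * (v ⬝ᵥ A *ᵥ v) := by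
  simp only [mulVec_add, mulVec_smul, dotProduct_add, add_dotProduct, smul_dotProduct,
    dotProduct_smul, smul_eq_mul, dotProduct_mulVec_symm hA x v]
  ring

theorem nonneg_of_forall_small {g q r : ℝ} (hr : 0 < r)
    (h : ∀ s, 0 < s → s < r → 0 ≤ 2 * s * g + s ^ 2 * q) : 0 ≤ g := by
  by_contra! hg
  -- With this `s` one has `s * |q| < -g`, so `2 * g + s * q` would be negative.
  set s := min (r / 2) (-g / (|q| + 1)) with hs
  have hq : 0 < |q| + 1 := by positivity
  have hs0 : 0 < s := lt_min (by positivity) (div_pos (by linarith) hq)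
  have h1 := h s hs0 (by linarith [min_le_left (r / 2) (-g / (|q| + 1))])
  have h2 : s * (|q| + 1) ≤ -g := (le_div_iff₀ hq).1 (min_le_right _ _)
  have h3 : 0 ≤ s * (2 * g + s * q) := by nlinarith
  have h4 : 0 ≤ 2 * g + s * q := nonneg_of_mul_nonneg_right h3 hs0
  nlinarith [le_abs_self q]

theorem exists_pos_add_smul_nonneg {n : ℕ} {x v : Fin n → ℝ} (hx : ∀ i, 0 ≤ x i)
    (hv : ∀ i, v i ≠ 0 → 0 < x i) : ∃ s : ℝ, 0 < s ∧ ∀ i, 0 ≤ (x + s • v) i := by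
  have h : ∀ᶠ s : ℝ in nhdsWithin 0 (Set.Ioi 0), ∀ i, 0 ≤ (x + s • v) i := by
    rw [Filter.eventually_all]
    intro i
    by_cases h0 : v i = 0
    · exact Filter.Eventually.of_forall fun s => by simpa [h0] using hx i
    · have hc : Continuous fun s : ℝ => (x + s • v) i := by
        simp only [Pi.add_apply, Pi.smul_apply, smul_eq_mul]
        fun_prop
      refine (hc.tendsto 0 |>.mono_left nhdsWithin_le_nhds).eventually (Filter.Eventually.mono
        (lt_mem_nhds (a := 0) ?_) fun _ => le_of_lt)
      simpa using hv i h0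
  obtain ⟨s, hs, hs'⟩ := (h.and self_mem_nhdsWithin).exists
  exact ⟨s, hs', hs⟩

theorem IsCopositive.mulVec_zero_nonneg {n : ℕ} {A : Matrix (Fin n) (Fin n) ℝ}
    (hA : IsCopositive A) {z : Fin n → ℝ} (hz : ∀ i, 0 ≤ z i) (h0 : z ⬝ᵥ A *ᵥ z = 0)
    (i : Fin n) : 0 ≤ (A *ᵥ z) i := by
  refine nonneg_of_forall_small (q := A i i) one_pos fun s hs _ => ?_
  have h := hA.2 (z + s • Pi.single i 1) fun j => by
    have : (0 : ℝ) ≤ (Pi.single i 1 : Fin n → ℝ) j := by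
      by_cases hij : j = i
      · subst hij; simp
      · simp [hij]
    have := hz j
    simp only [Pi.add_apply, Pi.smul_apply, smul_eq_mul]
    positivity
  rw [quad_add_smul hA.1, h0] at h
  simpa using h

theorem IsCopositive.mulVec_zero_eq_zero {n : ℕ} {A : Matrix (Fin n) (Fin n) ℝ}
    (hA : IsCopositive A) {z : Fin n → ℝ} (hz : ∀ i, 0 ≤ z i) (h0 : z ⬝ᵥ A *ᵥ z = 0)
    {i : Fin n} (hi : 0 < z i) : (A *ᵥ z) i = 0 := by
  have h := (Finset.sum_eq_zero_iff_of_nonneg fun j _ =>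
    mul_nonneg (hz j) (hA.mulVec_zero_nonneg hz h0 j)).1 h0 i (Finset.mem_univ _)
  exact (mul_eq_zero.1 h).resolve_left hi.ne'

/-- For small `s > 0` the vector `z + s v` is still nonnegative, and the linear term of the form at
it vanishes because `A z` is zero on the support of `z`. Only `s² vᵀAv` remains. -/
theorem IsCopositive.quad_nonneg_of_support {n : ℕ} {A : Matrix (Fin n) (Fin n) ℝ}
    (hA : IsCopositive A) {z v : Fin n → ℝ} (hz : ∀ i, 0 ≤ z i) (h0 : z ⬝ᵥ A *ᵥ z = 0)
    (hv : ∀ i, v i ≠ 0 → 0 < z i) : 0 ≤ v ⬝ᵥ A *ᵥ v := by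
  obtain ⟨s, hs, hs'⟩ := exists_pos_add_smul_nonneg hz hv
  have h := hA.2 _ hs'
  have h1 : v ⬝ᵥ A *ᵥ z = 0 := Finset.sum_eq_zero fun i _ => by
    by_cases hi : v i = 0
    · rw [hi, zero_mul]
    · rw [hA.mulVec_zero_eq_zero hz h0 (hv i hi), mul_zero]
  rw [quad_add_smul hA.1, h0, h1] at h
  have h2 : 0 ≤ s ^ 2 * (v ⬝ᵥ A *ᵥ v) := by linarith
  exact nonneg_of_mul_nonneg_right h2 (by positivity)

/-- The quadratic program `min yᵀ M y`, `y ≥ 0`, `y_k = 1`, has a solution if `M` is strictly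
copositive. -/
theorem exists_min_quad {n : ℕ} {M : Matrix (Fin n) (Fin n) ℝ} {ε : ℝ} (hε : 0 < ε)
    (hM : ∀ x : Fin n → ℝ, (∀ i, 0 ≤ x i) → ε * (x ⬝ᵥ x) ≤ x ⬝ᵥ M *ᵥ x) (k : Fin n) :
    ∃ y : Fin n → ℝ, (∀ i, 0 ≤ y i) ∧ y k = 1 ∧
      ∀ x : Fin n → ℝ, (∀ i, 0 ≤ x i) → x k = 1 → y ⬝ᵥ M *ᵥ y ≤ x ⬝ᵥ M *ᵥ x := by
  -- Outside the box `[0, R]ⁿ` the form is at least `ε R² ≥ M k k`, its value at the feasible point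
  -- `Pi.single k 1`, so the minimum over the compact box is global.
  set R : ℝ := 1 + M k k / ε with hR
  have hsingle : ∀ i, (0 : ℝ) ≤ (Pi.single k 1 : Fin n → ℝ) i := by
    intro i
    by_cases hik : i = k
    · subst hik; simp
    · simp [hik]
  have hMk : 0 < M k k := by
    have h := hM (Pi.single k 1) hsingle
    simp only [single_dotProduct, mulVec_single_one, Pi.single_eq_same, one_mul, mul_one, col_apply] at h
    linarith
  have hR1 : 1 ≤ R := by rw [hR]; linarith [div_pos hMk hε]
  have hεR : M k k ≤ ε * R ^ 2 := by
    have h1 : M k k ≤ ε * R := by rw [hR]; field_simp; linarith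
    nlinarith
  let S : Set (Fin n → ℝ) := Set.Icc 0 (fun _ => R) ∩ {y | y k = 1}
  have hS : IsCompact S :=
    isCompact_Icc.inter_right (isClosed_eq (continuous_apply k) continuous_const)
  have hkS : (Pi.single k 1 : Fin n → ℝ) ∈ S := by
    refine ⟨⟨hsingle, fun i => ?_⟩, by simp⟩
    by_cases hik : i = k
    · subst hik; simpa using hR1
    · simp [hik]; linarith
  have hcont : Continuous fun y : Fin n → ℝ => y ⬝ᵥ M *ᵥ y := by
    simp only [dotProduct, mulVec]
    fun_prop
  obtain ⟨y, hyS, hy⟩ := hS.exists_isMinOn ⟨_, hkS⟩ hcont.continuousOn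
  refine ⟨y, hyS.1.1, hyS.2, fun x hx hxk => ?_⟩
  by_cases hxS : x ∈ S
  · exact hy hxS
  · have h1 : ∃ i, R < x i := by
      by_contra! h
      exact hxS ⟨⟨hx, h⟩, hxk⟩
    obtain ⟨i, hi⟩ := h1
    have h2 : x i * x i ≤ x ⬝ᵥ x :=
      Finset.single_le_sum (f := fun i => x i * x i) (fun j _ => mul_self_nonneg _)
        (Finset.mem_univ i)
    have h3 : y ⬝ᵥ M *ᵥ y ≤ M k k := by
      have := hy hkS
      simpa using this
    have h4 : ε * R ^ 2 ≤ ε * (x ⬝ᵥ x) := by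
      apply mul_le_mul_of_nonneg_left _ hε.le
      nlinarith
    linarith [hM x hx]

/-- Here `g` is the gradient `M y` at the minimizer of the program with `y_k = 1`, with coordinate
`k` erased. First-order optimality gives `g ≥ 0` and complementarity `y_i g_i = 0`. Splitting `x = v
+ x_k y` with `v_k = 0` leaves the cross term `2 x_k xᵀg` plus two nonnegative terms. -/
theorem quad_lower_bound {n : ℕ} {M : Matrix (Fin n) (Fin n) ℝ} (hs : M.IsSymm) {ε : ℝ}
    (hε : 0 < ε) (hM : ∀ x : Fin n → ℝ, (∀ i, 0 ≤ x i) → ε * (x ⬝ᵥ x) ≤ x ⬝ᵥ M *ᵥ x)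
    (k : Fin n) (hk : ∀ v : Fin n → ℝ, v k = 0 → 0 ≤ v ⬝ᵥ M *ᵥ v) :
    ∃ g : Fin n → ℝ, (∀ i, 0 ≤ g i) ∧ g k = 0 ∧
      ∀ x : Fin n → ℝ, 2 * x k * (x ⬝ᵥ g) ≤ x ⬝ᵥ M *ᵥ x := by
  obtain ⟨y, hy0, hyk, hy⟩ := exists_min_quad hε hM k
  have hstep : ∀ i ≠ k, ∀ s : ℝ, 0 ≤ y i + s →
      0 ≤ 2 * s * (M *ᵥ y) i + s ^ 2 * M i i := by
    intro i hi s hs'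
    have h := hy (y + s • Pi.single i 1) (fun j => ?_) (by simp [hyk, hi.symm])
    · rw [quad_add_smul hs] at h
      simp only [single_dotProduct, mulVec_single_one, one_mul, col_apply] at h
      linarith
    · by_cases hj : j = i
      · subst hj; simpa using hs'
      · simpa [hj] using hy0 j
  have hg0 : ∀ i ≠ k, 0 ≤ (M *ᵥ y) i := fun i hi =>
    nonneg_of_forall_small one_pos fun s h0 _ => hstep i hi s (by linarith [hy0 i])
  have hgy : ∀ i ≠ k, y i * (M *ᵥ y) i = 0 := by
    intro i hi
    rcases (hy0 i).eq_or_lt with h | h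
    · rw [← h, zero_mul]
    · have h1 : 0 ≤ -(M *ᵥ y) i := nonneg_of_forall_small (q := M i i) h fun s h0 h1 => by
        have := hstep i hi (-s) (by linarith)
        linarith
      rw [le_antisymm (by linarith) (hg0 i hi), mul_zero]
  refine ⟨fun i => if i = k then 0 else (M *ᵥ y) i, fun i => ?_, if_pos rfl, fun x => ?_⟩
  · dsimp only
    split_ifs with h
    exacts [le_rfl, hg0 i h]
  · set v := x - x k • y with hv
    have hvk : v k = 0 := by simp [hv, hyk]
    have hx : x = v + x k • y := by simp [hv]
    have h1 : x ⬝ᵥ M *ᵥ x = v ⬝ᵥ M *ᵥ v + 2 * x k * (v ⬝ᵥ M *ᵥ y)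
        + x k ^ 2 * (y ⬝ᵥ M *ᵥ y) := by
      conv_lhs => rw [hx]
      rw [quad_add_smul hs, dotProduct_mulVec_symm hs y v]
    have h2 : v ⬝ᵥ M *ᵥ y = x ⬝ᵥ (fun i => if i = k then 0 else (M *ᵥ y) i) := by
      refine Finset.sum_congr rfl fun i _ => ?_
      dsimp only
      split_ifs with h
      · rw [h, hvk]; ring
      · simp only [hv, Pi.sub_apply, Pi.smul_apply, smul_eq_mul]
        linear_combination (-x k) * hgy i h
    have h3 : 0 ≤ y ⬝ᵥ M *ᵥ y := le_trans
      (mul_nonneg hε.le (Finset.sum_nonneg fun i _ => mul_self_nonneg _)) (hM y hy0)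
    rw [h1, h2]
    nlinarith [hk v hvk, mul_nonneg (sq_nonneg (x k)) h3]

/-- A copositive matrix of order `n` with a positive semi-definite principal submatrix of order
`n - 1` is positive semi-definite if every off-diagonal position of the remaining row is covered
by the support of a zero. -/
theorem IsCopositive.quad_nonneg_of_cover {n : ℕ} {A : Matrix (Fin n) (Fin n) ℝ}
    (hA : IsCopositive A) (k : Fin n) (hk : ∀ v : Fin n → ℝ, v k = 0 → 0 ≤ v ⬝ᵥ A *ᵥ v)
    (hcov : ∀ i, ∃ z : Fin n → ℝ, (∀ j, 0 ≤ z j) ∧ z ⬝ᵥ A *ᵥ z = 0 ∧ 0 < z k ∧ 0 < z i)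
    (x : Fin n → ℝ) : 0 ≤ x ⬝ᵥ A *ᵥ x := by
  choose z hz0 hzA hzk hzi using hcov
  let K : ℝ := x ⬝ᵥ x + 2 * |x k| * ∑ i, |x i| * (z i ⬝ᵥ z i / (2 * z i k * z i i))
  have hself : ∀ v : Fin n → ℝ, 0 ≤ v ⬝ᵥ v := fun v =>
    Finset.sum_nonneg fun i _ => mul_self_nonneg _
  -- For `A + ε I`, evaluating the lower bound at a zero covering `k` and `i` forces `g i = O(ε)`.
  -- So `xᵀAx` is bounded below by a multiple of `-ε`, and `ε` can be sent to 0.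
  have key : ∀ ε : ℝ, 0 < ε → 0 ≤ x ⬝ᵥ A *ᵥ x + ε * K := by
    intro ε hε
    let M := A + ε • (1 : Matrix (Fin n) (Fin n) ℝ)
    have hMq : ∀ v : Fin n → ℝ, v ⬝ᵥ M *ᵥ v = v ⬝ᵥ A *ᵥ v + ε * (v ⬝ᵥ v) := by
      intro v
      simp only [M, add_mulVec, smul_mulVec, one_mulVec, dotProduct_add, dotProduct_smul,
        smul_eq_mul]
    have hMs : M.IsSymm := hA.1.add (isSymm_one.smul ε)
    obtain ⟨g, hg0, hgk, hg⟩ := quad_lower_bound hMs hε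
      (fun v hv => by rw [hMq]; linarith [hA.2 v hv]) k
      (fun v hv => by rw [hMq]; exact add_nonneg (hk v hv) (mul_nonneg hε.le (hself v)))
    have hgi : ∀ i, g i ≤ ε * (z i ⬝ᵥ z i / (2 * z i k * z i i)) := by
      intro i
      have h := hg (z i)
      rw [hMq, hzA, zero_add] at h
      have h1 : z i i * g i ≤ z i ⬝ᵥ g :=
        Finset.single_le_sum (f := fun j => z i j * g j)
          (fun j _ => mul_nonneg (hz0 i j) (hg0 j)) (Finset.mem_univ i)
      have h2 := hzk i
      have h3 := hzi i
      rw [← mul_div_assoc, le_div_iff₀ (by positivity)]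
      nlinarith
    have h1 := hg x
    rw [hMq] at h1
    have h2 : |x ⬝ᵥ g| ≤ ε * ∑ i, |x i| * (z i ⬝ᵥ z i / (2 * z i k * z i i)) := by
      rw [Finset.mul_sum]
      refine (Finset.abs_sum_le_sum_abs _ _).trans (Finset.sum_le_sum fun i _ => ?_)
      rw [abs_mul, abs_of_nonneg (hg0 i), mul_left_comm]
      exact mul_le_mul_of_nonneg_left (hgi i) (abs_nonneg _)
    have h3 : -(2 * |x k| * |x ⬝ᵥ g|) ≤ 2 * x k * (x ⬝ᵥ g) := by
      have := neg_abs_le (x k * (x ⬝ᵥ g))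
      rw [abs_mul] at this
      linarith
    have h4 := mul_le_mul_of_nonneg_left h2 (by positivity : 0 ≤ 2 * |x k|)
    simp only [K]
    linarith
  by_contra! hneg
  have hK : 0 < |K| + 1 := by positivity
  have h := key (-(x ⬝ᵥ A *ᵥ x) / (2 * (|K| + 1))) (div_pos (by linarith) (by positivity))
  have h5 : -(x ⬝ᵥ A *ᵥ x) / (2 * (|K| + 1)) * K ≤ -(x ⬝ᵥ A *ᵥ x) / 2 := by
    rw [div_mul_eq_mul_div, div_le_div_iff₀ (by positivity) (by norm_num)]
    nlinarith [le_abs_self K]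
  linarith

/-! ### Cyclic windows of indices -/

section Cyclic

variable {n : ℕ} [NeZero n]

theorem cyc_eq_cyc_iff {a b : ℕ} : cyc n a = cyc n b ↔ a % n = b % n := by
  rw [cyc, cyc, Fin.ext_iff]
  rfl

theorem cyc_val (i : Fin n) : cyc n (i : ℕ) = i := by
  apply Fin.ext
  simp [cyc]

theorem cyc_add_mul_period (t q : ℕ) : cyc n (t + n * q) = cyc n t := by
  rw [cyc_eq_cyc_iff, Nat.add_mul_mod_self_left]

theorem cyc_castLE (hn : 3 ≤ n) (t : Fin (n - 3)) :
    cyc n (t : ℕ) = Fin.castLE (Nat.sub_le n 3) t := by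
  apply Fin.ext
  simp only [cyc, Fin.val_ofNat, Fin.val_castLE]
  exact Nat.mod_eq_of_lt (by omega)

theorem sum_cyc {M : Type*} [AddCommMonoid M] (k : ℕ) (f : Fin n → M) :
    ∑ i, f i = ∑ i ∈ Finset.range n, f (cyc n (k + i)) := by
  rw [Finset.sum_range, ← Equiv.sum_comp (Equiv.addLeft (cyc n k)) f]
  refine Finset.sum_congr rfl fun i _ => congrArg f ?_
  apply Fin.ext
  simp [cyc, Fin.val_add]

theorem exists_cyc_eq (k : ℕ) (r : Fin n) : ∃ i < n, r = cyc n (k + i) := by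
  refine ⟨((Equiv.addLeft (cyc n k)).symm r : Fin n), Fin.is_lt _, ?_⟩
  conv_lhs => rw [← (Equiv.addLeft (cyc n k)).apply_symm_apply r]
  apply Fin.ext
  simp only [Equiv.coe_addLeft, Fin.val_add, cyc, Fin.val_ofNat, Nat.mod_add_mod]

theorem cyc_add_injective (k : ℕ) {i j : ℕ} (hi : i < n) (hj : j < n)
    (h : cyc n (k + i) = cyc n (k + j)) : i = j := by
  rw [cyc_eq_cyc_iff] at h
  have := Nat.ModEq.add_left_cancel' k (show k + i ≡ k + j [MOD n] from h)
  rwa [Nat.ModEq, Nat.mod_eq_of_lt hi, Nat.mod_eq_of_lt hj] at this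

theorem cyc_cyc_add (t i : ℕ) : cyc n ((cyc n t : ℕ) + i) = cyc n (t + i) := by
  rw [cyc_eq_cyc_iff]
  simp [cyc]

theorem idx_cyc (t : ℕ) (i : Fin (n - 2)) : idx n (cyc n t) i = cyc n (t + i) :=
  cyc_cyc_add t i

variable {u : Fin n → Fin n → ℝ}

theorem HasCirculantSupports.coeff_pos (hu : HasCirculantSupports u) (t : ℕ) {i : ℕ}
    (hi : i < n - 2) : 0 < coeff u t i := by
  have h : cyc n (t + i) ∈ {i | 0 < u (cyc n t) i} := by
    rw [(hu (cyc n t)).2]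
    exact ⟨⟨i, hi⟩, idx_cyc t _⟩
  exact h

theorem HasCirculantSupports.coeff_eq_zero (hu : HasCirculantSupports u) (t : ℕ) {i : ℕ}
    (hi : n - 2 ≤ i) (hin : i < n) : coeff u t i = 0 := by
  refine le_antisymm (not_lt.1 fun h => ?_) ((hu _).1 _)
  have h1 : cyc n (t + i) ∈ {i | 0 < u (cyc n t) i} := h
  rw [(hu (cyc n t)).2] at h1
  obtain ⟨j, hj⟩ := h1
  rw [idx_cyc] at hj
  have := cyc_add_injective t (by omega) hin hj
  omega

theorem HasCirculantSupports.sum_eq (hu : HasCirculantSupports u) (t : ℕ) (f : Fin n → ℝ) :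
    ∑ i, f i * u (cyc n t) i =
      ∑ i ∈ Finset.range (n - 2), f (cyc n (t + i)) * coeff u t i := by
  rw [sum_cyc t]
  symm
  refine Finset.sum_subset (Finset.range_mono (Nat.sub_le n 2)) fun i hi hi' => ?_
  rw [Finset.mem_range] at hi hi'
  change _ * coeff u t i = 0
  rw [hu.coeff_eq_zero t (not_lt.1 hi') hi, mul_zero]

/-- Every pair of indices is contained in the support of one of the vectors. -/
theorem HasCirculantSupports.exists_cover (hn : 5 ≤ n) (hu : HasCirculantSupports u)
    (k i : Fin n) : ∃ j, 0 < u j k ∧ 0 < u j i := by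
  obtain ⟨m, hm, rfl⟩ := exists_cyc_eq (k : ℕ) i
  by_cases h : m < n - 2
  · refine ⟨k, ?_, ?_⟩
    · simpa [coeff, cyc_val] using hu.coeff_pos (k : ℕ) (i := 0) (by omega)
    · simpa [coeff, cyc_val] using hu.coeff_pos (k : ℕ) h
  -- The offset of `k` from `k + m` is `n - m ≤ 2`, which lies inside the window because `n ≥ 5`.
  · refine ⟨cyc n (k + m), ?_, ?_⟩
    · have := hu.coeff_pos (k + m) (i := n - m) (by omega)
      rw [coeff, show (k : ℕ) + m + (n - m) = k + n by omega, cyc_add_period, cyc_val] at this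
      exact this
    · simpa [coeff] using hu.coeff_pos ((k : ℕ) + m) (i := 0) (by omega)

theorem mulVec_eq_sum_window (hu : HasCirculantSupports u) (A : Matrix (Fin n) (Fin n) ℝ) (t : ℕ)
    (r : Fin n) : (A *ᵥ u (cyc n t)) r =
      ∑ i ∈ Finset.range (n - 2), A r (cyc n (t + i)) * coeff u t i :=
  hu.sum_eq t (A r)

theorem mem_spaceA_iff (hu : HasCirculantSupports u) {A : Matrix (Fin n) (Fin n) ℝ} :
    A ∈ spaceA u ↔ A.IsSymm ∧ ∀ t i, i < n - 2 → (A *ᵥ u (cyc n t)) (cyc n (t + i)) = 0 := by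
  have h : ∀ t (i : Fin (n - 2)), (A.submatrix (idx n (cyc n t)) (idx n (cyc n t)) *ᵥ
      (u (cyc n t) ∘ idx n (cyc n t))) i = (A *ᵥ u (cyc n t)) (cyc n (t + i)) := by
    intro t i
    rw [mulVec_eq_sum_window hu, Finset.sum_range]
    simp only [mulVec, dotProduct, submatrix_apply, Function.comp_apply, idx_cyc, coeff]
  constructor
  · rintro ⟨hA, hA'⟩
    refine ⟨hA, fun t i hi => ?_⟩
    rw [← h t ⟨i, hi⟩, hA' (cyc n t)]
    rfl
  · rintro ⟨hA, hA'⟩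
    refine ⟨hA, fun j => funext fun i => ?_⟩
    have := h j i
    rw [cyc_val] at this
    rw [this]
    have := hA' j i i.2
    rwa [cyc_val] at this

end Cyclic

/-! ### Forms compatible with a matrix -/

section Forms

variable {n : ℕ} [NeZero n] {u : Fin n → Fin n → ℝ}

theorem sum_coeff_smul_ev (hn : 3 ≤ n) (t : ℕ) :
    ∑ i ∈ Finset.range (n - 2), coeff u t i • (ev (t + i) : Module.Dual ℝ (solSpace u)) = 0 := by
  ext x
  have h := x.2 t
  rw [show n - 3 + 1 = n - 2 by omega] at h
  simpa using h

theorem sum_form_mul_coeff (hn : 3 ≤ n)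
    (B : LinearMap.BilinForm ℝ (Module.Dual ℝ (solSpace u))) (f : Module.Dual ℝ (solSpace u))
    (t : ℕ) : ∑ i ∈ Finset.range (n - 2), B f (ev (t + i)) * coeff u t i = 0 := by
  have h := congrArg (B f) (sum_coeff_smul_ev (u := u) hn t)
  simpa [mul_comm] using h

theorem form_ext (hn : 5 ≤ n) (hu : HasCirculantSupports u)
    {B C : LinearMap.BilinForm ℝ (Module.Dual ℝ (solSpace u))}
    (h : ∀ t < n - 3, ∀ s < n - 3, B (ev t) (ev s) = C (ev t) (ev s)) : B = C := by
  refine LinearMap.BilinForm.ext_basis (evBasis (coeff_ne_zero hn hu)) fun i j => ?_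
  rw [evBasis_apply, evBasis_apply]
  exact h i i.2 j j.2

/-- `B(e_t, e_s) = A_{ts}` whenever `t` and `s` are at distance at most `n - 3`. -/
def Compat (A : Matrix (Fin n) (Fin n) ℝ)
    (B : LinearMap.BilinForm ℝ (Module.Dual ℝ (solSpace u))) : Prop :=
  ∀ t s : ℕ, s ≤ t + (n - 3) → t ≤ s + (n - 3) → B (ev t) (ev s) = A (cyc n t) (cyc n s)

/-- The slack of the linear inequality with index `t`. -/
def slack (B : LinearMap.BilinForm ℝ (Module.Dual ℝ (solSpace u))) (t : ℕ) : ℝ :=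
  B (ev t) (ev (t + 2)) - B (ev (t + n)) (ev (t + 2))

theorem Lam_isSymm (hn : 5 ≤ n) (hu : HasCirculantSupports u) (A : spaceA u)
    (f g : Module.Dual ℝ (solSpace u)) : Lam hn hu A f g = Lam hn hu A g f := by
  have h : Lam hn hu A = LinearMap.flip (Lam hn hu A) := by
    refine form_ext hn hu fun t ht s hs => ?_
    have h1 := Lam_ev hn hu A ⟨t, ht⟩ ⟨s, hs⟩
    have h2 := Lam_ev hn hu A ⟨s, hs⟩ ⟨t, ht⟩
    rw [← A.2.1.apply] at h1
    exact h1.trans h2.symm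
  exact LinearMap.congr_fun (LinearMap.congr_fun h f) g

theorem eq_of_weighted_sum_eq {m : ℕ} {c f g : ℕ → ℝ} (hc : c m ≠ 0)
    (hf : ∑ i ∈ Finset.range (m + 1), f i * c i = 0)
    (hg : ∑ i ∈ Finset.range (m + 1), g i * c i = 0) (h : ∀ i < m, f i = g i) : f m = g m := by
  rw [Finset.sum_range_succ] at hf hg
  rw [Finset.sum_congr rfl fun i hi => by rw [h i (Finset.mem_range.1 hi)]] at hf
  exact mul_right_cancel₀ hc (by linarith)

/-- Within a window, rows of `A` and of `B` satisfy the same relation with nonzero last coefficient,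
so agreement on the first `n - 3` indices propagates to the last one. Dropping the first index then
moves the agreement one step forward in time. -/
theorem compat_Lam (hn : 5 ≤ n) (hu : HasCirculantSupports u) (A : spaceA u) :
    Compat (A : Matrix (Fin n) (Fin n) ℝ) (Lam hn hu A) := by
  have hsymm := A.2.1
  have hA := ((mem_spaceA_iff hu).1 A.2).2
  have hS := Lam_isSymm hn hu A
  set B := Lam hn hu A
  have extend : ∀ t, (∀ a < n - 3, ∀ b < n - 3,
        B (ev (t + a)) (ev (t + b)) = A.1 (cyc n (t + a)) (cyc n (t + b))) →
      ∀ a < n - 2, ∀ b < n - 2,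
        B (ev (t + a)) (ev (t + b)) = A.1 (cyc n (t + a)) (cyc n (t + b)) := by
    intro t h
    have last : ∀ a < n - 2, (∀ b < n - 3,
          B (ev (t + a)) (ev (t + b)) = A.1 (cyc n (t + a)) (cyc n (t + b))) →
        B (ev (t + a)) (ev (t + (n - 3))) = A.1 (cyc n (t + a)) (cyc n (t + (n - 3))) := by
      intro a ha hb
      have h1 := sum_form_mul_coeff (by omega) B (ev (t + a)) t
      have h2 := hA t a ha
      rw [mulVec_eq_sum_window hu] at h2
      rw [show n - 2 = n - 3 + 1 by omega] at h1 h2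
      exact eq_of_weighted_sum_eq (f := fun i => B (ev (t + a)) (ev (t + i)))
        (g := fun i => A.1 (cyc n (t + a)) (cyc n (t + i))) (coeff_ne_zero hn hu t) h1 h2 hb
    have h1 : ∀ a < n - 3, ∀ b < n - 2,
        B (ev (t + a)) (ev (t + b)) = A.1 (cyc n (t + a)) (cyc n (t + b)) := by
      intro a ha b hb
      rcases (show b ≤ n - 3 by omega).lt_or_eq with h' | rfl
      · exact h a ha b h'
      · exact last a (by omega) (h a ha)
    intro a ha b hb
    rcases (show a ≤ n - 3 by omega).lt_or_eq with h' | rfl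
    · exact h1 a h' b hb
    · have h2 : ∀ b < n - 3, B (ev (t + (n - 3))) (ev (t + b)) =
          A.1 (cyc n (t + (n - 3))) (cyc n (t + b)) := fun b hb => by
        rw [hS, ← hsymm.apply]
        exact h1 b hb _ (by omega)
      rcases (show b ≤ n - 3 by omega).lt_or_eq with h' | rfl
      · exact h2 b h'
      · exact last _ (by omega) h2
  have base : ∀ t, ∀ a < n - 3, ∀ b < n - 3,
      B (ev (t + a)) (ev (t + b)) = A.1 (cyc n (t + a)) (cyc n (t + b)) := by
    intro t
    induction t with
    | zero =>
      intro a ha b hb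
      have := Lam_ev hn hu A ⟨a, ha⟩ ⟨b, hb⟩
      rw [← cyc_castLE (by omega), ← cyc_castLE (by omega)] at this
      simpa using this
    | succ t ih =>
      intro a ha b hb
      rw [add_assoc, add_assoc]
      exact extend t ih _ (by omega) _ (by omega)
  intro t s hs ht
  rcases le_total t s with h | h
  · obtain ⟨b, rfl⟩ := Nat.exists_eq_add_of_le h
    exact extend t (base t) 0 (by omega) b (by omega)
  · obtain ⟨b, rfl⟩ := Nat.exists_eq_add_of_le h
    exact extend s (base s) b (by omega) 0 (by omega)

theorem form_ev_add_period_of_basis (hn : 5 ≤ n) (hu : HasCirculantSupports u)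
    {B : LinearMap.BilinForm ℝ (Module.Dual ℝ (solSpace u))}
    (h : ∀ t < n - 3, ∀ s < n - 3,
      B (ev t) (ev s) = B (monodromyAdj u (ev t)) (monodromyAdj u (ev s))) (t s : ℕ) :
    B (ev (t + n)) (ev (s + n)) = B (ev t) (ev s) := by
  have h1 : B = LinearMap.BilinForm.comp B (monodromyAdj u) (monodromyAdj u) :=
    form_ext hn hu h
  exact (LinearMap.congr_fun (LinearMap.congr_fun h1 (ev t)) (ev s)).symm

theorem Compat.form_ev_add_period (hn : 5 ≤ n) (hu : HasCirculantSupports u)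
    {A : Matrix (Fin n) (Fin n) ℝ} {B : LinearMap.BilinForm ℝ (Module.Dual ℝ (solSpace u))}
    (hAB : Compat A B) (t s : ℕ) : B (ev (t + n)) (ev (s + n)) = B (ev t) (ev s) := by
  refine form_ev_add_period_of_basis hn hu (fun t ht s hs => ?_) t s
  rw [monodromyAdj_ev, monodromyAdj_ev, hAB _ _ (by omega) (by omega),
    hAB _ _ (by omega) (by omega), cyc_add_period, cyc_add_period]

theorem slack_periodic {B : LinearMap.BilinForm ℝ (Module.Dual ℝ (solSpace u))}
    (h : ∀ t s, B (ev (t + n)) (ev (s + n)) = B (ev t) (ev s)) :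
    Function.Periodic (slack B) n := by
  intro t
  rw [slack, slack, show t + n + 2 = t + 2 + n by omega, h, h]

/-- The functional `ev (t + n)` is within distance `n - 3` of every index of the window starting at
`t + 2` except the first. Subtracting the relation for `B` therefore cancels all other terms. -/
theorem Compat.mulVec_first (hn : 5 ≤ n) (hu : HasCirculantSupports u)
    {A : Matrix (Fin n) (Fin n) ℝ} {B : LinearMap.BilinForm ℝ (Module.Dual ℝ (solSpace u))}
    (hAB : Compat A B) (t : ℕ) :
    (A *ᵥ u (cyc n (t + 2))) (cyc n t) = coeff u (t + 2) 0 * slack B t := by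
  have h := sum_form_mul_coeff (by omega) B (ev (t + n)) (t + 2)
  rw [mulVec_eq_sum_window hu, ← sub_zero (∑ i ∈ _, _), ← h, ← Finset.sum_sub_distrib,
    Finset.sum_eq_single_of_mem 0 (Finset.mem_range.2 (by omega))]
  · rw [slack, add_zero, hAB t (t + 2) (by omega) (by omega)]
    ring
  · intro i hi hi0
    rw [Finset.mem_range] at hi
    rw [hAB (t + n) (t + 2 + i) (by omega) (by omega), cyc_add_period, sub_self]

/-- The mirror image: only the last index `s + n` of the window is too far from `s + 2`. -/
theorem Compat.mulVec_last (hn : 5 ≤ n) (hu : HasCirculantSupports u)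
    {A : Matrix (Fin n) (Fin n) ℝ} {B : LinearMap.BilinForm ℝ (Module.Dual ℝ (solSpace u))}
    (hS : ∀ f g, B f g = B g f) (hAB : Compat A B) (s : ℕ) :
    (A *ᵥ u (cyc n (s + 3))) (cyc n (s + 2)) = coeff u (s + 3) (n - 3) * slack B s := by
  have h := sum_form_mul_coeff (by omega) B (ev (s + 2)) (s + 3)
  rw [mulVec_eq_sum_window hu, ← sub_zero (∑ i ∈ _, _), ← h, ← Finset.sum_sub_distrib,
    Finset.sum_eq_single_of_mem (n - 3) (Finset.mem_range.2 (by omega))]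
  · rw [slack, show s + 3 + (n - 3) = s + n by omega, cyc_add_period, hS (ev s), hS (ev (s + n)),
      hAB (s + 2) s (by omega) (by omega)]
    ring
  · intro i hi hi0
    rw [Finset.mem_range] at hi
    rw [hAB (s + 2) (s + 3 + i) (by omega) (by omega), sub_self]

theorem Compat.mulVec_support (hn : 5 ≤ n) (hu : HasCirculantSupports u)
    {A : Matrix (Fin n) (Fin n) ℝ} {B : LinearMap.BilinForm ℝ (Module.Dual ℝ (solSpace u))}
    (hAB : Compat A B) (t : ℕ) {i : ℕ} (hi : i < n - 2) :
    (A *ᵥ u (cyc n t)) (cyc n (t + i)) = 0 := by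
  rw [mulVec_eq_sum_window hu, ← sum_form_mul_coeff (by omega) B (ev (t + i)) t]
  refine Finset.sum_congr rfl fun j hj => ?_
  rw [Finset.mem_range] at hj
  rw [hAB (t + i) (t + j) (by omega) (by omega)]

theorem Compat.quad_zero (hn : 5 ≤ n) (hu : HasCirculantSupports u)
    {A : Matrix (Fin n) (Fin n) ℝ} {B : LinearMap.BilinForm ℝ (Module.Dual ℝ (solSpace u))}
    (hAB : Compat A B) (j : Fin n) : u j ⬝ᵥ A *ᵥ u j = 0 := by
  have h := hu.sum_eq (j : ℕ) (A *ᵥ u j)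
  rw [cyc_val] at h
  rw [dotProduct_comm]
  refine h.trans (Finset.sum_eq_zero fun i hi => ?_)
  have := hAB.mulVec_support hn hu j (Finset.mem_range.1 hi)
  rw [cyc_val] at this
  rw [this, zero_mul]

/-- The matrix applied to a zero, in terms of the slacks. -/
theorem Compat.mulVec_cases (hn : 5 ≤ n) (hu : HasCirculantSupports u)
    {A : Matrix (Fin n) (Fin n) ℝ} {B : LinearMap.BilinForm ℝ (Module.Dual ℝ (solSpace u))}
    (hS : ∀ f g, B f g = B g f) (hAB : Compat A B) (j r : Fin n) :
    ∃ a t, 0 ≤ a ∧ (A *ᵥ u j) r = a * slack B t := by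
  obtain ⟨i, hi, rfl⟩ := exists_cyc_eq (j : ℕ) r
  rcases lt_or_ge i (n - 2) with h | h
  · refine ⟨0, 0, le_rfl, ?_⟩
    have := hAB.mulVec_support hn hu j h
    rw [cyc_val] at this
    rw [this, zero_mul]
  · rcases (show i = n - 2 ∨ i = n - 1 by omega) with rfl | rfl
    · refine ⟨_, j + (n - 2), (hu.coeff_pos (j + (n - 2) + 2) (i := 0) (by omega)).le, ?_⟩
      · have := hAB.mulVec_first hn hu (j + (n - 2))
        rw [show (j : ℕ) + (n - 2) + 2 = j + n by omega, cyc_add_period, cyc_val] at this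
        rw [this, show (j : ℕ) + (n - 2) + 2 = j + n by omega]
    · refine ⟨_, j + (n - 3), (hu.coeff_pos (j + (n - 3) + 3) (i := n - 3) (by omega)).le, ?_⟩
      · have := hAB.mulVec_last hn hu hS (j + (n - 3))
        rw [show (j : ℕ) + (n - 3) + 3 = j + n by omega, cyc_add_period, cyc_val,
          show (j : ℕ) + (n - 3) + 2 = j + (n - 1) by omega] at this
        rw [this, show (j : ℕ) + (n - 3) + 3 = j + n by omega]

/-! ### The quadratic form on vectors with a zero coordinate -/

theorem Compat.entry_eq (hn : 5 ≤ n) (hu : HasCirculantSupports u)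
    {A : Matrix (Fin n) (Fin n) ℝ} {B : LinearMap.BilinForm ℝ (Module.Dual ℝ (solSpace u))}
    (hA : A.IsSymm) (hS : ∀ f g, B f g = B g f) (hAB : Compat A B) (k : ℕ) {i j : ℕ}
    (hi : i < n - 1) (hj : j < n - 1) :
    A (cyc n (k + 1 + i)) (cyc n (k + 1 + j)) = B (ev (k + 1 + i)) (ev (k + 1 + j)) +
      (if i = 0 then if j = n - 2 then slack B (k + n - 1) else 0 else 0) +
      (if i = n - 2 then if j = 0 then slack B (k + n - 1) else 0 else 0) := by
  have h : A (cyc n (k + 1)) (cyc n (k + 1 + (n - 2))) =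
      B (ev (k + 1)) (ev (k + 1 + (n - 2))) + slack B (k + n - 1) := by
    rw [slack, show k + n - 1 + 2 = k + 1 + n by omega, show k + 1 + (n - 2) = k + n - 1 by omega,
      hAB.form_ev_add_period hn hu, hS (ev (k + n - 1)) (ev (k + 1)),
      hAB (k + n - 1) (k + 1 + n) (by omega) (by omega), cyc_add_period, hA.apply]
    ring
  by_cases h1 : i = 0 ∧ j = n - 2
  · obtain ⟨rfl, rfl⟩ := h1
    rw [if_pos rfl, if_pos rfl, if_neg (by omega), add_zero, add_zero, h]
  by_cases h2 : i = n - 2 ∧ j = 0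
  · obtain ⟨rfl, rfl⟩ := h2
    rw [if_neg (by omega), if_pos rfl, if_pos rfl, add_zero, add_zero, ← hA.apply, h, hS]
  · rw [hAB _ _ (by omega) (by omega)]
    have h3 : (if i = 0 then if j = n - 2 then slack B (k + n - 1) else 0 else 0) = 0 := by
      split_ifs <;> first | rfl | omega
    have h4 : (if i = n - 2 then if j = 0 then slack B (k + n - 1) else 0 else 0) = 0 := by
      split_ifs <;> first | rfl | omega
    rw [h3, h4, add_zero, add_zero]

theorem sum_add_corners {m p : ℕ} (hm : 0 < m) (hp : p < m) (y : ℕ → ℝ) (b : ℕ → ℕ → ℝ) (D : ℝ) :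
    ∑ i ∈ Finset.range m, y i * ∑ j ∈ Finset.range m,
      (b i j + (if i = 0 then if j = p then D else 0 else 0) +
        (if i = p then if j = 0 then D else 0 else 0)) * y j =
      ∑ i ∈ Finset.range m, ∑ j ∈ Finset.range m, y i * (y j * b i j) + 2 * (y 0 * y p) * D := by
  simp only [add_mul, Finset.sum_add_distrib, mul_add, ite_mul, zero_mul, Finset.sum_ite_irrel,
    Finset.sum_const_zero, Finset.sum_ite_eq', Finset.mem_range, hm, hp, if_true, mul_ite, mul_zero]
  simp only [Finset.mul_sum, mul_comm (b _ _)]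
  ring

/-- Take `f = ∑ x_i e_i` over the times `k + 1, …, k + n - 1`. Two of these are more than `n - 3`
apart only if they are the endpoints, which contribute the slack term. -/
theorem Compat.quad_eq (hn : 5 ≤ n) (hu : HasCirculantSupports u)
    {A : Matrix (Fin n) (Fin n) ℝ} {B : LinearMap.BilinForm ℝ (Module.Dual ℝ (solSpace u))}
    (hA : A.IsSymm) (hS : ∀ f g, B f g = B g f) (hAB : Compat A B) (k : ℕ) {x : Fin n → ℝ}
    (hx : x (cyc n k) = 0) : ∃ f : Module.Dual ℝ (solSpace u),
      x ⬝ᵥ A *ᵥ x = B f f + 2 * (x (cyc n (k + 1)) * x (cyc n (k + n - 1))) *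
        slack B (k + n - 1) := by
  have hsum : ∀ f : Fin n → ℝ, f (cyc n k) = 0 →
      ∑ i, f i = ∑ i ∈ Finset.range (n - 1), f (cyc n (k + 1 + i)) := by
    intro f hf
    have h := Finset.sum_range_succ' (fun i => f (cyc n (k + i))) (n - 1)
    rw [show n - 1 + 1 = n by omega, add_zero, hf, add_zero] at h
    rw [sum_cyc k, h]
    simp only [add_assoc, add_comm 1]
  refine ⟨∑ i ∈ Finset.range (n - 1), x (cyc n (k + 1 + i)) • ev (k + 1 + i), ?_⟩
  have hlhs : x ⬝ᵥ A *ᵥ x = ∑ i ∈ Finset.range (n - 1), x (cyc n (k + 1 + i)) *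
      ∑ j ∈ Finset.range (n - 1), (B (ev (k + 1 + i)) (ev (k + 1 + j)) +
      (if i = 0 then if j = n - 2 then slack B (k + n - 1) else 0 else 0) +
      (if i = n - 2 then if j = 0 then slack B (k + n - 1) else 0 else 0)) *
        x (cyc n (k + 1 + j)) := by
    rw [dotProduct, hsum _ (by rw [hx, zero_mul])]
    refine Finset.sum_congr rfl fun i hi => ?_
    rw [mulVec, dotProduct, hsum _ (by rw [hx, mul_zero])]
    congr 1
    refine Finset.sum_congr rfl fun j hj => ?_
    rw [hAB.entry_eq hn hu hA hS k (Finset.mem_range.1 hi) (Finset.mem_range.1 hj)]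
  rw [hlhs, sum_add_corners (by omega) (by omega)]
  simp only [map_sum, map_smul, LinearMap.sum_apply, LinearMap.smul_apply, smul_eq_mul, add_zero,
    show k + 1 + (n - 2) = k + n - 1 by omega, Finset.mul_sum]
  exact congrArg (· + _) (Finset.sum_congr rfl fun i _ => Finset.sum_congr rfl fun j _ => by
    rw [hS])

end Forms

section Faces

variable {n : ℕ} [NeZero n] {u : Fin n → Fin n → ℝ}

/-! ### From forms to matrices -/

theorem Compat.quad_nonneg_of_slack (hn : 5 ≤ n) (hu : HasCirculantSupports u)
    {A : Matrix (Fin n) (Fin n) ℝ} {B : LinearMap.BilinForm ℝ (Module.Dual ℝ (solSpace u))}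
    (hA : A.IsSymm) (hB : B.IsPosSemidef) (hAB : Compat A B) (k : Fin n) {x : Fin n → ℝ}
    (hxk : x k = 0)
    (hx : 0 ≤ x (cyc n (k + 1)) * x (cyc n (k + n - 1)) * slack B (k + n - 1)) :
    0 ≤ x ⬝ᵥ A *ᵥ x := by
  obtain ⟨f, hf⟩ := hAB.quad_eq hn hu hA hB.isSymm.eq k (x := x) (by rwa [cyc_val])
  rw [hf]
  linarith [hB.isNonneg.nonneg f]

/-- The ratio test: `r` is the minimum of `x_i / z_i` over the support of `z`. -/
theorem exists_sub_smul_nonneg {m : ℕ} {x z : Fin m → ℝ} (hx : ∀ i, 0 ≤ x i)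
    (hz : ∀ i, 0 ≤ z i) {j : Fin m} (hj : 0 < z j) :
    ∃ r : ℝ, 0 ≤ r ∧ (∀ i, 0 ≤ (x - r • z) i) ∧ ∃ k, (x - r • z) k = 0 := by
  obtain ⟨k, hk, hmin⟩ := (Finset.univ.filter fun i => 0 < z i).exists_min_image
    (fun i => x i / z i) ⟨j, by simpa using hj⟩
  have hk : 0 < z k := by simpa using hk
  refine ⟨x k / z k, div_nonneg (hx k) hk.le, fun i => ?_, k, ?_⟩
  · simp only [Pi.sub_apply, Pi.smul_apply, smul_eq_mul, sub_nonneg]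
    rcases (hz i).eq_or_lt with h | h
    · rw [← h, mul_zero]
      exact hx i
    · exact (le_div_iff₀ h).1 (hmin i (by simpa using h))
  · simp [hk.ne']

theorem Compat.isCopositive (hn : 5 ≤ n) (hu : HasCirculantSupports u)
    {A : Matrix (Fin n) (Fin n) ℝ} {B : LinearMap.BilinForm ℝ (Module.Dual ℝ (solSpace u))}
    (hA : A.IsSymm) (hB : B.IsPosSemidef) (hAB : Compat A B) (hs : ∀ t, 0 ≤ slack B t) :
    IsCopositive A := by
  refine ⟨hA, fun x hx => ?_⟩
  obtain ⟨j, hj, -⟩ := hu.exists_cover hn 0 0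
  obtain ⟨r, hr, hy, k, hk⟩ := exists_sub_smul_nonneg hx (hu j).1 hj
  set y := x - r • u j with hy_def
  have hx_eq : x = y + r • u j := by simp [hy_def]
  have h1 : 0 ≤ y ⬝ᵥ A *ᵥ y := hAB.quad_nonneg_of_slack hn hu hA hB k hk
    (mul_nonneg (mul_nonneg (hy _) (hy _)) (hs _))
  have h2 : 0 ≤ y ⬝ᵥ A *ᵥ u j := Finset.sum_nonneg fun i _ => by
    obtain ⟨a, t, ha, h⟩ := hAB.mulVec_cases hn hu hB.isSymm.eq j i
    rw [h]
    exact mul_nonneg (hy i) (mul_nonneg ha (hs t))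
  rw [hx_eq, quad_add_smul hA, hAB.quad_zero hn hu, dotProduct_mulVec_symm hA (u j) y]
  nlinarith [mul_nonneg hr h2]

/-- With zero slacks `A u^j = 0`, so any real multiple of `u^j` may be subtracted to annihilate a
coordinate, and no sign condition on `x` is needed. -/
theorem Compat.posSemidef (hn : 5 ≤ n) (hu : HasCirculantSupports u)
    {A : Matrix (Fin n) (Fin n) ℝ} {B : LinearMap.BilinForm ℝ (Module.Dual ℝ (solSpace u))}
    (hA : A.IsSymm) (hB : B.IsPosSemidef) (hAB : Compat A B) (hs : ∀ t, slack B t = 0) :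
    A.PosSemidef := by
  refine posSemidef_iff_symm.2 ⟨hA, fun x => ?_⟩
  obtain ⟨j, hj, -⟩ := hu.exists_cover hn 0 0
  set y := x - (x 0 / u j 0) • u j with hy_def
  have hx_eq : x = y + (x 0 / u j 0) • u j := by simp [hy_def]
  have h1 : 0 ≤ y ⬝ᵥ A *ᵥ y := hAB.quad_nonneg_of_slack hn hu hA hB 0
    (by simp [hy_def, hj.ne']) (by rw [hs, mul_zero])
  have h2 : A *ᵥ u j = 0 := funext fun i => by
    obtain ⟨a, t, ha, h⟩ := hAB.mulVec_cases hn hu hB.isSymm.eq j i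
    rw [h, hs, mul_zero, Pi.zero_apply]
  rw [hx_eq, quad_add_smul hA, hAB.quad_zero hn hu, dotProduct_mulVec_symm hA (u j) y, h2]
  simpa using h1

/-- The matrix with entries `B(e_t, e_s)`, where `t`, `s` are representatives of the row and the
column index at distance at most `n - 3`. -/
def matrixOfForm (B : LinearMap.BilinForm ℝ (Module.Dual ℝ (solSpace u))) :
    Matrix (Fin n) (Fin n) ℝ :=
  Matrix.of fun i j =>
    if (j : ℕ) ≤ i + (n - 3) then
      if (i : ℕ) ≤ j + (n - 3) then B (ev i) (ev j) else B (ev i) (ev (j + n))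
    else B (ev (i + n)) (ev j)

theorem matrixOfForm_isSymm
    {B : LinearMap.BilinForm ℝ (Module.Dual ℝ (solSpace u))} (hS : ∀ f g, B f g = B g f) :
    (matrixOfForm B).IsSymm := by
  refine IsSymm.ext fun i j => ?_
  simp only [matrixOfForm, of_apply]
  split_ifs
  · exact hS _ _
  · exact hS _ _
  · exact hS _ _
  · omega

/-- Monodromy invariance reduces the claim to a first time below `n`; the second family of
equalities makes the choice of representatives immaterial. -/
theorem compat_matrixOfForm (hn : 5 ≤ n) (hu : HasCirculantSupports u)
    {B : LinearMap.BilinForm ℝ (Module.Dual ℝ (solSpace u))} (hB : B ∈ formsF u) :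
    Compat (matrixOfForm B) B := by
  obtain ⟨hpsd, h1, h2, -⟩ := hB
  have hS := hpsd.isSymm.eq
  have hper := form_ev_add_period_of_basis hn hu h1
  have hper' : ∀ q t s, B (ev (t + n * q)) (ev (s + n * q)) = B (ev t) (ev s) := by
    intro q t s
    induction q with
    | zero => simp
    | succ q ih => rw [mul_add, mul_one, ← add_assoc, ← add_assoc, hper, ih]
  have hfst : ∀ t < n, ∀ b ≤ n - 3,
      B (ev t) (ev (t + b)) = matrixOfForm B (cyc n t) (cyc n (t + b)) := by
    intro t ht b hb
    have htv : ((cyc n t : Fin n) : ℕ) = t := Nat.mod_eq_of_lt ht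
    by_cases hlt : t + b < n
    · have hsv : ((cyc n (t + b) : Fin n) : ℕ) = t + b := Nat.mod_eq_of_lt hlt
      rw [matrixOfForm, of_apply, htv, hsv, if_pos (by omega), if_pos (by omega)]
    · obtain ⟨s, hs⟩ := Nat.exists_eq_add_of_le (not_lt.1 hlt)
      rw [hs, add_comm n s, cyc_add_period]
      have hsv : ((cyc n s : Fin n) : ℕ) = s := Nat.mod_eq_of_lt (by omega)
      rw [matrixOfForm, of_apply, htv, hsv, if_pos (by omega)]
      split_ifs with h
      · rw [hS (ev t) (ev s), h2 s t (by omega) ht (by omega) (by omega), monodromyAdj_ev, hS]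
      · rfl
  have hle : ∀ t b, b ≤ n - 3 →
      B (ev t) (ev (t + b)) = matrixOfForm B (cyc n t) (cyc n (t + b)) := by
    intro t b hb
    have h3 := hfst (t % n) (Nat.mod_lt _ (by omega)) b hb
    have h4 := hper' (t / n) (t % n) (t % n + b)
    rw [h3, add_right_comm, Nat.mod_add_div, ← cyc_add_mul_period (t % n) (t / n),
      ← cyc_add_mul_period (t % n + b) (t / n), add_right_comm, Nat.mod_add_div] at h4
    exact h4
  intro t s hs ht
  rcases le_total t s with h | h
  · obtain ⟨b, rfl⟩ := Nat.exists_eq_add_of_le h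
    exact hle t b (by omega)
  · obtain ⟨b, rfl⟩ := Nat.exists_eq_add_of_le h
    rw [hS, ← (matrixOfForm_isSymm hS).apply]
    exact hle s b (by omega)

theorem Compat.mem_spaceA (hn : 5 ≤ n) (hu : HasCirculantSupports u)
    {A : Matrix (Fin n) (Fin n) ℝ} {B : LinearMap.BilinForm ℝ (Module.Dual ℝ (solSpace u))}
    (hA : A.IsSymm) (hAB : Compat A B) : A ∈ spaceA u :=
  (mem_spaceA_iff hu).2 ⟨hA, fun t _ hi => hAB.mulVec_support hn hu t hi⟩

theorem Compat.Lam_eq (hn : 5 ≤ n) (hu : HasCirculantSupports u) {A : spaceA u}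
    {B : LinearMap.BilinForm ℝ (Module.Dual ℝ (solSpace u))}
    (hAB : Compat (A : Matrix (Fin n) (Fin n) ℝ) B) : Lam hn hu A = B :=
  form_ext hn hu fun t ht s hs => by
    rw [hAB t s (by omega) (by omega), compat_Lam hn hu A t s (by omega) (by omega)]

theorem exists_representatives (hn : 5 ≤ n) (i j : Fin n) :
    ∃ t s : ℕ, s ≤ t + (n - 3) ∧ t ≤ s + (n - 3) ∧ cyc n t = i ∧ cyc n s = j := by
  obtain ⟨m, hm, rfl⟩ := exists_cyc_eq (i : ℕ) j
  by_cases h : m ≤ n - 3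
  · exact ⟨i, i + m, by omega, by omega, cyc_val i, rfl⟩
  · exact ⟨i + n, i + m, by omega, by omega, by rw [cyc_add_period, cyc_val], rfl⟩

theorem Lam_injective (hn : 5 ≤ n) (hu : HasCirculantSupports u) :
    Function.Injective (Lam hn hu) := by
  intro A A' h
  ext i j
  obtain ⟨t, s, h1, h2, rfl, rfl⟩ := exists_representatives hn i j
  rw [← compat_Lam hn hu A t s h1 h2, ← compat_Lam hn hu A' t s h1 h2, h]

theorem formsF_subset_range (hn : 5 ≤ n) (hu : HasCirculantSupports u) :
    formsF u ⊆ Set.range (Lam hn hu) := fun B hB => by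
  have hAB := compat_matrixOfForm hn hu hB
  exact ⟨⟨_, hAB.mem_spaceA hn hu (matrixOfForm_isSymm hB.1.isSymm.eq)⟩, Compat.Lam_eq hn hu hAB⟩

theorem slack_nonneg_of_mem_formsF (hn : 5 ≤ n) (hu : HasCirculantSupports u)
    {B : LinearMap.BilinForm ℝ (Module.Dual ℝ (solSpace u))} (hB : B ∈ formsF u) (t : ℕ) :
    0 ≤ slack B t := by
  rw [← (slack_periodic (form_ev_add_period_of_basis hn hu hB.2.1)).map_mod_nat]
  exact sub_nonneg.2 (hB.2.2.2 _ (Nat.mod_lt _ (by omega)))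

theorem slack_eq_zero_of_mem_formsP (hn : 5 ≤ n) (hu : HasCirculantSupports u)
    {B : LinearMap.BilinForm ℝ (Module.Dual ℝ (solSpace u))} (hB : B ∈ formsP u) (t : ℕ) :
    slack B t = 0 := by
  rw [← (slack_periodic (form_ev_add_period_of_basis hn hu hB.1.2.1)).map_mod_nat]
  exact sub_eq_zero.2 (hB.2 _ (Nat.mod_lt _ (by omega)))

/-! ### From matrices to forms -/

theorem mem_spaceA_of_mem_faceF (hu : HasCirculantSupports u)
    {A : Matrix (Fin n) (Fin n) ℝ} (hA : A ∈ faceF u) : A ∈ spaceA u :=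
  (mem_spaceA_iff hu).2 ⟨hA.1.1, fun t _ hi =>
    hA.1.mulVec_zero_eq_zero (hu _).1 (hA.2 _) (hu.coeff_pos t hi)⟩

/-- `B(f, f)` is the value of `A` at a vector supported on the first `n - 3` indices, hence inside
the support of the zero `u 0`. -/
theorem Lam_isPosSemidef (hn : 5 ≤ n) (hu : HasCirculantSupports u) (A : spaceA u)
    (hA : (A : Matrix (Fin n) (Fin n) ℝ) ∈ faceF u) : (Lam hn hu A).IsPosSemidef := by
  refine ⟨⟨Lam_isSymm hn hu A⟩, ⟨fun f => ?_⟩⟩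
  have hf := (evBasis (coeff_ne_zero hn hu)).sum_repr f
  simp only [evBasis_apply] at hf
  set y := fun i => (evBasis (coeff_ne_zero hn hu)).repr f i
  let x : Fin n → ℝ := ∑ i, y i • Pi.single (Fin.castLE (Nat.sub_le n 3) i) (1 : ℝ)
  have h1 : Lam hn hu A f f = x ⬝ᵥ A.1 *ᵥ x := by
    rw [← Matrix.toBilin'_apply', ← hf]
    simp only [x, map_sum, map_smul, LinearMap.sum_apply, LinearMap.smul_apply, Lam_ev,
      Matrix.toBilin'_single, y]
  rw [h1]
  refine hA.1.quad_nonneg_of_support (hu 0).1 (hA.2 0) fun i hi => ?_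
  have h2 : (i : ℕ) < n - 3 := by
    by_contra! h
    refine hi ?_
    simp only [x, Finset.sum_apply]
    refine Finset.sum_eq_zero fun j _ => ?_
    have hne : i ≠ Fin.castLE (Nat.sub_le n 3) j := by
      rintro rfl
      exact absurd h (not_le.2 j.2)
    simp [hne]
  have h3 := hu.coeff_pos 0 (i := i) (by omega)
  rwa [coeff, zero_add, cyc_val, show cyc n 0 = 0 from rfl] at h3

theorem Lam_mem_formsF (hn : 5 ≤ n) (hu : HasCirculantSupports u) (A : spaceA u)
    (hA : (A : Matrix (Fin n) (Fin n) ℝ) ∈ faceF u) : Lam hn hu A ∈ formsF u := by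
  have hAB := compat_Lam hn hu A
  refine ⟨Lam_isPosSemidef hn hu A hA, fun t _ s _ => ?_, fun t s h1 h2 h3 h4 => ?_,
    fun t _ => ?_⟩
  · rw [monodromyAdj_ev, monodromyAdj_ev, hAB.form_ev_add_period hn hu]
  · rw [monodromyAdj_ev, hAB t s (by omega) (by omega), hAB (t + n) s (by omega) (by omega),
      cyc_add_period]
  · rw [monodromyAdj_ev, ge_iff_le, ← sub_nonneg]
    have h := hA.1.mulVec_zero_nonneg (hu (cyc n (t + 2))).1 (hA.2 _) (cyc n t)
    rw [hAB.mulVec_first hn hu] at h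
    exact nonneg_of_mul_nonneg_right h (hu.coeff_pos _ (by omega))

theorem faceP_subset_faceF {n : ℕ} {u : Fin n → Fin n → ℝ} : faceP u ⊆ faceF u := fun _ hA =>
  have h := posSemidef_iff_symm.1 hA.1
  ⟨⟨h.1, fun x _ => h.2 x⟩, hA.2⟩

theorem Lam_mem_formsP (hn : 5 ≤ n) (hu : HasCirculantSupports u) (A : spaceA u)
    (hA : (A : Matrix (Fin n) (Fin n) ℝ) ∈ faceP u) : Lam hn hu A ∈ formsP u := by
  refine ⟨Lam_mem_formsF hn hu A (faceP_subset_faceF hA), fun t _ => ?_⟩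
  have h1 : A.1 *ᵥ u (cyc n (t + 2)) = 0 :=
    (hA.1.dotProduct_mulVec_zero_iff _).1 (by simpa using hA.2 _)
  have h := (compat_Lam hn hu A).mulVec_first hn hu t
  rw [h1, Pi.zero_apply, zero_eq_mul] at h
  exact sub_eq_zero.1 (h.resolve_left (hu.coeff_pos _ (by omega)).ne')

theorem mem_faceF_of_Lam_mem (hn : 5 ≤ n) (hu : HasCirculantSupports u) (A : spaceA u)
    (hA : Lam hn hu A ∈ formsF u) : (A : Matrix (Fin n) (Fin n) ℝ) ∈ faceF u :=
  have hAB := compat_Lam hn hu A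
  ⟨hAB.isCopositive hn hu A.2.1 hA.1 (slack_nonneg_of_mem_formsF hn hu hA),
    hAB.quad_zero hn hu⟩

theorem mem_faceP_of_Lam_mem (hn : 5 ≤ n) (hu : HasCirculantSupports u) (A : spaceA u)
    (hA : Lam hn hu A ∈ formsP u) : (A : Matrix (Fin n) (Fin n) ℝ) ∈ faceP u :=
  have hAB := compat_Lam hn hu A
  ⟨hAB.posSemidef hn hu A.2.1 hA.1.1 (slack_eq_zero_of_mem_formsP hn hu hA),
    hAB.quad_zero hn hu⟩

/-- If one of the linear inequalities holds with equality, then all of them do. -/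
theorem mem_formsP_of_slack_eq_zero (hn : 5 ≤ n) (hu : HasCirculantSupports u)
    {B : LinearMap.BilinForm ℝ (Module.Dual ℝ (solSpace u))} (hB : B ∈ formsF u) {t : ℕ}
    (ht : slack B t = 0) : B ∈ formsP u := by
  obtain ⟨A, rfl⟩ := formsF_subset_range hn hu hB
  have hA := mem_faceF_of_Lam_mem hn hu A hB
  have hAB := compat_Lam hn hu A
  -- Coordinate `t + 1` is deleted: its neighbours `t` and `t + 2` are the corners of the remaining
  -- window, and their slack is the vanishing one.
  refine Lam_mem_formsP hn hu A ⟨posSemidef_iff_symm.2 ⟨A.2.1,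
    hA.1.quad_nonneg_of_cover (cyc n (t + 1)) (fun v hv => ?_) fun i => ?_⟩, hA.2⟩
  · refine hAB.quad_nonneg_of_slack hn hu A.2.1 hB.1 _ hv (le_of_eq ?_)
    have hper := slack_periodic (form_ev_add_period_of_basis hn hu hB.2.1)
    have h : ((cyc n (t + 1) : ℕ) + n - 1) % n = t % n := by
      have h1 : ((cyc n (t + 1) : ℕ) + n - 1 + 1) ≡ t + 1 [MOD n] := by
        rw [show (cyc n (t + 1) : ℕ) + n - 1 + 1 = cyc n (t + 1) + n by omega]
        simp [Nat.ModEq, cyc]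
      exact Nat.ModEq.add_right_cancel' 1 h1
    rw [← hper.map_mod_nat, h, hper.map_mod_nat, ht, mul_zero]
  · obtain ⟨j, hj, hj'⟩ := hu.exists_cover hn (cyc n (t + 1)) i
    exact ⟨u j, (hu j).1, hA.2 j, hj, hj'⟩

/-- In a decomposition `P + N` both forms vanish at each `u j`. Since every index pair lies in some
support, each entry of the nonnegative `N` is zero. -/
theorem isExceptional_of_mem_faceF (hn : 5 ≤ n) (hu : HasCirculantSupports u)
    {A : Matrix (Fin n) (Fin n) ℝ} (hA : A ∈ faceF u) (hA' : A ∉ faceP u) : IsExceptional A := by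
  refine ⟨hA.1, ?_⟩
  rintro ⟨P, N, hP, ⟨-, hN⟩, rfl⟩
  have hN0 : N = 0 := by
    ext k i
    obtain ⟨j, hj, hj'⟩ := hu.exists_cover hn k i
    have h0 := hA.2 j
    have h1 := (posSemidef_iff_symm.1 hP).2 (u j)
    rw [add_mulVec, dotProduct_add] at h0
    have h2 : u j i * N k i ≤ (N *ᵥ u j) k := by
      rw [mul_comm]
      exact Finset.single_le_sum (f := fun i => N k i * u j i)
        (fun i _ => mul_nonneg (hN k i) ((hu j).1 i)) (Finset.mem_univ i)
    have hNu : ∀ k, 0 ≤ (N *ᵥ u j) k := fun k => by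
      rw [mulVec, dotProduct]
      exact Finset.sum_nonneg fun i _ => mul_nonneg (hN k i) ((hu j).1 i)
    have h3 : u j k * (N *ᵥ u j) k ≤ u j ⬝ᵥ N *ᵥ u j :=
      Finset.single_le_sum (f := fun k => u j k * (N *ᵥ u j) k)
        (fun k _ => mul_nonneg ((hu j).1 k) (hNu k)) (Finset.mem_univ k)
    have h4 : u j k * (u j i * N k i) ≤ 0 := by
      linarith [mul_le_mul_of_nonneg_left h2 hj.le]
    refine le_antisymm ?_ (hN k i)
    rw [← mul_assoc] at h4
    exact nonpos_of_mul_nonpos_right h4 (mul_pos hj hj')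
  rw [hN0, add_zero] at hA hA'
  exact hA' ⟨hP, hA.2⟩

end Faces

end CircCop

theorem mainTheorem1 (n : ℕ) [NeZero n] (hn : 5 ≤ n) (u : Fin n → Fin n → ℝ)
    (hu : CircCop.HasCirculantSupports u) :
    -- `Λ` is injective and its image contains the set of forms, so that `Λ⁻¹` below is also the
    -- image under the inverse map
    (Function.Injective (CircCop.Lam hn hu) ∧
      CircCop.formsF u ⊆ Set.range (CircCop.Lam hn hu)) ∧
    -- `F_u = Λ⁻¹[ℱ_u]`
    CircCop.faceF u = Subtype.val '' (CircCop.Lam hn hu ⁻¹' CircCop.formsF u) ∧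
    -- `P_u = Λ⁻¹[𝒫_u]`
    CircCop.faceP u = Subtype.val '' (CircCop.Lam hn hu ⁻¹' CircCop.formsP u) ∧
    -- outside `𝒫_u` all inequalities are strict
    (∀ B ∈ CircCop.formsF u \ CircCop.formsP u, ∀ t < n,
      B (CircCop.ev t) (CircCop.ev (t + 2)) >
        B (CircCop.monodromyAdj u (CircCop.ev t)) (CircCop.ev (t + 2))) ∧
    -- `F_u ∖ P_u` consists of exceptional matrices
    ∀ A ∈ CircCop.faceF u \ CircCop.faceP u, CircCop.IsExceptional A := by
  refine ⟨⟨CircCop.Lam_injective hn hu, CircCop.formsF_subset_range hn hu⟩, ?_, ?_, ?_, ?_⟩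
  · ext A
    constructor
    · exact fun hA => ⟨⟨A, CircCop.mem_spaceA_of_mem_faceF hu hA⟩,
        CircCop.Lam_mem_formsF hn hu _ hA, rfl⟩
    · rintro ⟨A, hA, rfl⟩
      exact CircCop.mem_faceF_of_Lam_mem hn hu A hA
  · ext A
    constructor
    · exact fun hA => ⟨⟨A, CircCop.mem_spaceA_of_mem_faceF hu (CircCop.faceP_subset_faceF hA)⟩,
        CircCop.Lam_mem_formsP hn hu _ hA, rfl⟩
    · rintro ⟨A, hA, rfl⟩
      exact CircCop.mem_faceP_of_Lam_mem hn hu A hA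
  · rintro B ⟨hB, hB'⟩ t -
    refine sub_pos.1 ((CircCop.slack_nonneg_of_mem_formsF hn hu hB t).lt_of_ne fun h => ?_)
    exact hB' (CircCop.mem_formsP_of_slack_eq_zero hn hu hB h.symm)
  · exact fun A hA => CircCop.isExceptional_of_mem_faceF hn hu hA.1 hA.2
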